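/- Let $V$ be a set of propositional variables. Formulas are given by $A,B ::= \bot \mid p \mid \neg A \mid A\wedge B \mid A\Rightarrow B$ with $p\in V$, and $\top,\vee,\to,\leftrightarrow$ are the usual abbreviations. A sequent is a finite multiset of formulas, read disjunctively. A rule $\Gamma_1\ \dots\ \Gamma_n/\Gamma_0$ ($n\ge 0$) consists of sequents; a rule set is a set of rules. For a rule set $R$, the formulas $A$ with $\mathsf HR\vdash A$ form the least set that contains all substitution instances of propositional tautologies, is closed under modus ponens, and contains $\bigvee\Gamma_0$ whenever it contains $\bigvee\Gamma_1,\dots,\bigvee\Gamma_n$ and $\Gamma_1\dots\Gamma_n/\Gamma_0\in R$. The sequents $\Gamma$ with $\mathsf GR\vdash\Gamma$ form the least set that contains $A,\neg A,\Gamma$ and $\neg\bot,\Gamma$ for all $A,\Gamma$, is closed under $$\frac{\Gamma,\neg A,\neg B}{\Gamma,\neg(A\wedge B)}\qquad \frac{\Gamma,A\quad \Gamma,B}{\Gamma,A\wedge B}\qquad \frac{\Gamma,A}{\Gamma,\neg\neg A},$$ and is closed under the rules in $R$. A rule set $R'$ is admissible in $\mathsf GR$ if $\mathsf GR\vdash\Gamma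 \iff \mathsf G(R\cup R')\vdash\Gamma$ for all sequents $\Gamma$. The logic $\mathsf{CK}$ has as rules all instances of $$\frac{A\leftrightarrow A'}{(A\Rightarrow B)\leftrightarrow(A'\Rightarrow B)}\qquad \frac{B_1\wedge\dots\wedge B_n\to B}{(A\Rightarrow B_1)\wedge\dots\wedge(A\Rightarrow B_n)\to(A\Rightarrow B)}\ (n\ge 0).$$ For $L\subseteq\{\mathsf{ID},\mathsf{MP},\mathsf{CEM}\}$, write $L$ also for the rule set that extends $\mathsf{CK}$ by all instances of the axioms in $L$, where $\mathsf{ID}$ is $A\Rightarrow A$, $\mathsf{MP}$ is $(A\Rightarrow B)\to(A\to B)$ and $\mathsf{CEM}$ is $(A\Rightarrow B)\vee(A\Rightarrow\neg B)$. Write $A_0=\dots=A_n$ for the list of the sequents $\neg A_0,A_i$ and $\neg A_i,A_0$, $1\le i\le n$. Consider the following rule schemas, where $\Gamma$ is an arbitrary sequent and $0\le j\le n$: $$(\mathsf{CK}_g)\ \frac{A_0=\dots=A_n\quad \neg B_1,\dots,\neg B_n,B_0}{\neg(A_1\Rightarrow B_1),\dots,\neg(A_n\Rightarrow B_n),(A_0\Rightarrow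 B_0),\Gamma}$$ $$(\mathsf{CKCEM}_g)\ \frac{A_0=\dots=A_n\quad B_0,\dots,B_j,\neg B_{j+1},\dots,\neg B_n}{(A_0\Rightarrow B_0),\dots,(A_j\Rightarrow B_j),\neg(A_{j+1}\Rightarrow B_{j+1}),\dots,\neg(A_n\Rightarrow B_n),\Gamma}$$ $$(\mathsf{MP}_g)\ \frac{A,\neg(A\Rightarrow B),\Gamma\quad \neg B,\neg(A\Rightarrow B),\Gamma}{\neg(A\Rightarrow B),\Gamma}\qquad (\mathsf{MPCEM}_g)\ \frac{A,(A\Rightarrow B),\Gamma\quad B,(A\Rightarrow B),\Gamma}{(A\Rightarrow B),\Gamma}$$ and let $(\mathsf{CKID}_g)$ and $(\mathsf{CKCEMID}_g)$ be $(\mathsf{CK}_g)$ and $(\mathsf{CKCEM}_g)$, respectively, with the additional formula $\neg A_0$ in the last premise. The rule set $L_g$ consists of all instances of - $(\mathsf{CK}_g)$ if $\mathsf{ID},\mathsf{CEM}\notin L$; $(\mathsf{CKID}_g)$ if $\mathsf{ID}\in L$, $\mathsf{CEM}\notin L$; $(\mathsf{CKCEM}_g)$ if $\mathsf{CEM}\in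 L$, $\mathsf{ID}\notin L$; $(\mathsf{CKCEMID}_g)$ if $\mathsf{ID},\mathsf{CEM}\in L$; - additionally $(\mathsf{MP}_g)$ if $\mathsf{MP}\in L$; and additionally $(\mathsf{MPCEM}_g)$ if $\mathsf{MP},\mathsf{CEM}\in L$. **Theorem.** For every $L\subseteq\{\mathsf{ID},\mathsf{MP},\mathsf{CEM}\}$ and every formula $A$, if $\mathsf HL\vdash A$ then $\mathsf GL_g\vdash A$. Moreover, cut elimination holds in $\mathsf GL_g$: the set of all instances of the cut rule $$\frac{\Gamma,A\qquad \Delta,\neg A}{\Gamma,\Delta}$$ is admissible in $\mathsf GL_g$. -/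

import Mathlib

namespace CondLogic

universe u

/-- Formulas of conditional logic over a set `V` of propositional variables:
`A, B ::= ⊥ | p | ¬ A | A ∧ B | A ⇒ B`. -/
inductive Form (V : Type u) : Type u
  | bot : Form V
  | var : V → Form V
  | neg : Form V → Form V
  | conj : Form V → Form V → Form V
  | cond : Form V → Form V → Form V

namespace Form

variable {V : Type u}

/-- `⊤ := ¬ ⊥`. -/
def top : Form V := neg bot

/-- `A ∨ B := ¬ (¬ A ∧ ¬ B)`. -/
def disj (A B : Form V) : Form V := neg (conj (neg A) (neg B))

/-- `A → B := ¬ (A ∧ ¬ B)`. -/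
def imp (A B : Form V) : Form V := neg (conj A (neg B))

/-- `A ↔ B := (A → B) ∧ (B → A)`. -/
def iff (A B : Form V) : Form V := conj (imp A B) (imp B A)

/-- Finite conjunctions `A₁ ∧ … ∧ Aₙ`; the empty conjunction is `⊤`. -/
def listConj : List (Form V) → Form V
  | [] => top
  | [A] => A
  | A :: B :: l => conj A (listConj (B :: l))

/-- Finite disjunctions `A₁ ∨ … ∨ Aₙ`; the empty disjunction is `⊥`. -/
def listDisj : List (Form V) → Form V
  | [] => bot
  | [A] => A
  | A :: B :: l => disj A (listDisj (B :: l))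

/-- Uniform substitution `A σ`. -/
def subst (σ : V → Form V) : Form V → Form V
  | bot => bot
  | var p => σ p
  | neg A => neg (subst σ A)
  | conj A B => conj (subst σ A) (subst σ B)
  | cond A B => cond (subst σ A) (subst σ B)

/-- The formula does not contain the conditional. -/
def IsPropositional : Form V → Prop
  | bot => True
  | var _ => True
  | neg A => IsPropositional A
  | conj A B => IsPropositional A ∧ IsPropositional B
  | cond _ _ => False

/-- Truth of a formula under a valuation of the variables; used only for purely propositional
formulas, so that the value at a conditional is irrelevant. -/
def eval (v : V → Prop) : Form V → Prop
  | bot => False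
  | var p => v p
  | neg A => ¬ eval v A
  | conj A B => eval v A ∧ eval v B
  | cond _ _ => False

/-- Propositional tautologies. -/
def IsTautology (A : Form V) : Prop :=
  IsPropositional A ∧ ∀ v : V → Prop, eval v A

end Form

/-- Sequents are finite multisets of formulas. -/
abbrev Sequent (V : Type u) : Type u := Multiset (Form V)

/-- The disjunction `⋁ Γ` of (some enumeration of) a sequent. -/
noncomputable def bigDisj {V : Type u} (Γ : Sequent V) : Form V := Form.listDisj Γ.toList

/-- A rule `Γ₁ … Γₙ / Γ₀` (`n ≥ 0`). -/
structure Rule (V : Type u) : Type u where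
  premises : List (Sequent V)
  conclusion : Sequent V

/-- Derivability `H R ⊢ A` in the Hilbert system given by the rule set `R`. -/
inductive HDerivable {V : Type u} (R : Set (Rule V)) : Form V → Prop
  | taut (A : Form V) (σ : V → Form V) : A.IsTautology → HDerivable R (A.subst σ)
  | mp (A B : Form V) : HDerivable R A → HDerivable R (A.imp B) → HDerivable R B
  | rule (r : Rule V) : r ∈ R → (∀ Γ ∈ r.premises, HDerivable R (bigDisj Γ)) →
      HDerivable R (bigDisj r.conclusion)

/-- Derivability `G R ⊢ Γ` in the sequent calculus given by the rule set `R`. -/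
inductive GDerivable {V : Type u} (R : Set (Rule V)) : Sequent V → Prop
  | ax (A : Form V) (Γ : Sequent V) : GDerivable R (A ::ₘ A.neg ::ₘ Γ)
  | negBot (Γ : Sequent V) : GDerivable R (Form.bot.neg ::ₘ Γ)
  | negConj (A B : Form V) (Γ : Sequent V) :
      GDerivable R (A.neg ::ₘ B.neg ::ₘ Γ) → GDerivable R ((A.conj B).neg ::ₘ Γ)
  | conj (A B : Form V) (Γ : Sequent V) :
      GDerivable R (A ::ₘ Γ) → GDerivable R (B ::ₘ Γ) → GDerivable R (A.conj B ::ₘ Γ)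
  | negNeg (A : Form V) (Γ : Sequent V) :
      GDerivable R (A ::ₘ Γ) → GDerivable R (A.neg.neg ::ₘ Γ)
  | rule (r : Rule V) : r ∈ R → (∀ Γ ∈ r.premises, GDerivable R Γ) → GDerivable R r.conclusion

/-- The rule set `R'` is admissible in `G R`. -/
def GAdmissible {V : Type u} (R' R : Set (Rule V)) : Prop :=
  ∀ Γ : Sequent V, GDerivable R Γ ↔ GDerivable (R ∪ R') Γ

/-- All instances of the cut rule `Γ, A    Δ, ¬A / Γ, Δ`. -/
def cutRules (V : Type u) : Set (Rule V) :=
  {r | ∃ (A : Form V) (Γ Δ : Sequent V), r = ⟨[A ::ₘ Γ, A.neg ::ₘ Δ], Γ + Δ⟩}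

/-! ### The Hilbert systems -/

/-- The additional principles: identity, conditional modus ponens, conditional excluded middle. -/
inductive Principle : Type
  | ID
  | MP
  | CEM
  deriving DecidableEq

/-- `A ↔ A' / (A ⇒ B) ↔ (A' ⇒ B)`. -/
def RCEA (V : Type u) : Set (Rule V) :=
  {r | ∃ A A' B : Form V, r = ⟨[{A.iff A'}], {(A.cond B).iff (A'.cond B)}⟩}

/-- `B₁ ∧ … ∧ Bₙ → B / (A ⇒ B₁) ∧ … ∧ (A ⇒ Bₙ) → (A ⇒ B)`, for `n ≥ 0`. -/
def RCK (V : Type u) : Set (Rule V) :=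
  {r | ∃ (A B : Form V) (Bs : List (Form V)),
    r = ⟨[{(Form.listConj Bs).imp B}],
      {(Form.listConj (Bs.map fun C => A.cond C)).imp (A.cond B)}⟩}

/-- All instances of the given principle, as rules without premises:
`A ⇒ A`, `(A ⇒ B) → (A → B)`, and `(A ⇒ B) ∨ (A ⇒ ¬B)`, respectively. -/
def principleRules (V : Type u) : Principle → Set (Rule V)
  | .ID => {r | ∃ A : Form V, r = ⟨[], {A.cond A}⟩}
  | .MP => {r | ∃ A B : Form V, r = ⟨[], {(A.cond B).imp (A.imp B)}⟩}
  | .CEM => {r | ∃ A B : Form V, r = ⟨[], {(A.cond B).disj (A.cond B.neg)}⟩}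

/-- The Hilbert rule set of the extension of `CK` by the principles in `L`. -/
def hilbertRules (V : Type u) (L : Finset Principle) : Set (Rule V) :=
  RCEA V ∪ RCK V ∪ {r | ∃ P ∈ L, r ∈ principleRules V P}

/-! ### The sequent systems -/

/-- The sequents `¬A₀, Aᵢ` and `¬Aᵢ, A₀` (`1 ≤ i ≤ n`) abbreviated by `A₀ = A₁ = … = Aₙ`. -/
def eqSequents {V : Type u} (A₀ : Form V) (As : List (Form V)) : List (Sequent V) :=
  As.flatMap fun A => [{A₀.neg, A}, {A.neg, A₀}]

/-- The sequent `B₁, …, Bₘ` of consequents of the list `(A₁, B₁), …, (Aₘ, Bₘ)`. -/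
def posConsequents {V : Type u} (l : List (Form V × Form V)) : Sequent V :=
  ↑(l.map fun x => x.2)

/-- The sequent `¬B₁, …, ¬Bₘ` for the list `(A₁, B₁), …, (Aₘ, Bₘ)`. -/
def negConsequents {V : Type u} (l : List (Form V × Form V)) : Sequent V :=
  ↑(l.map fun x => x.2.neg)

/-- The sequent `A₁ ⇒ B₁, …, Aₘ ⇒ Bₘ` for the list `(A₁, B₁), …, (Aₘ, Bₘ)`. -/
def posConds {V : Type u} (l : List (Form V × Form V)) : Sequent V :=
  ↑(l.map fun x => x.1.cond x.2)

/-- The sequent `¬(A₁ ⇒ B₁), …, ¬(Aₘ ⇒ Bₘ)` for the list `(A₁, B₁), …, (Aₘ, Bₘ)`. -/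
def negConds {V : Type u} (l : List (Form V × Form V)) : Sequent V :=
  ↑(l.map fun x => (x.1.cond x.2).neg)

/-- Premises `A₀ = … = Aₙ` and `¬B₁, …, ¬Bₙ, B₀`, conclusion
`¬(A₁ ⇒ B₁), …, ¬(Aₙ ⇒ Bₙ), (A₀ ⇒ B₀), Γ`; here `N` is the list of the `(Aᵢ, Bᵢ)`, `i ≥ 1`. -/
def CKg (V : Type u) : Set (Rule V) :=
  {r | ∃ (A₀ B₀ : Form V) (N : List (Form V × Form V)) (Γ : Sequent V),
    r = ⟨eqSequents A₀ (N.map fun x => x.1) ++ [B₀ ::ₘ negConsequents N],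
      A₀.cond B₀ ::ₘ (negConds N + Γ)⟩}

/-- As `CKg`, with the premise `¬A₀, ¬B₁, …, ¬Bₙ, B₀` instead of `¬B₁, …, ¬Bₙ, B₀`. -/
def CKIDg (V : Type u) : Set (Rule V) :=
  {r | ∃ (A₀ B₀ : Form V) (N : List (Form V × Form V)) (Γ : Sequent V),
    r = ⟨eqSequents A₀ (N.map fun x => x.1) ++ [A₀.neg ::ₘ B₀ ::ₘ negConsequents N],
      A₀.cond B₀ ::ₘ (negConds N + Γ)⟩}

/-- Premises `A, ¬(A ⇒ B), Γ` and `¬B, ¬(A ⇒ B), Γ`, conclusion `¬(A ⇒ B), Γ`. -/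
def MPg (V : Type u) : Set (Rule V) :=
  {r | ∃ (A B : Form V) (Γ : Sequent V),
    r = ⟨[A ::ₘ (A.cond B).neg ::ₘ Γ, B.neg ::ₘ (A.cond B).neg ::ₘ Γ],
      (A.cond B).neg ::ₘ Γ⟩}

/-- Premises `A₀ = … = Aₙ` and `B₀, …, Bⱼ, ¬Bⱼ₊₁, …, ¬Bₙ`, conclusion
`(A₀ ⇒ B₀), …, (Aⱼ ⇒ Bⱼ), ¬(Aⱼ₊₁ ⇒ Bⱼ₊₁), …, ¬(Aₙ ⇒ Bₙ), Γ`, for `0 ≤ j ≤ n`; here `P` is the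
list of the `(Aᵢ, Bᵢ)` with `1 ≤ i ≤ j`, and `N` the list of those with `j < i ≤ n`. -/
def CKCEMg (V : Type u) : Set (Rule V) :=
  {r | ∃ (A₀ B₀ : Form V) (P N : List (Form V × Form V)) (Γ : Sequent V),
    r = ⟨eqSequents A₀ ((P ++ N).map fun x => x.1) ++
        [B₀ ::ₘ (posConsequents P + negConsequents N)],
      A₀.cond B₀ ::ₘ (posConds P + negConds N + Γ)⟩}

/-- As `CKCEMg`, with the additional formula `¬A₀` in the last premise. -/
def CKCEMIDg (V : Type u) : Set (Rule V) :=
  {r | ∃ (A₀ B₀ : Form V) (P N : List (Form V × Form V)) (Γ : Sequent V),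
    r = ⟨eqSequents A₀ ((P ++ N).map fun x => x.1) ++
        [A₀.neg ::ₘ B₀ ::ₘ (posConsequents P + negConsequents N)],
      A₀.cond B₀ ::ₘ (posConds P + negConds N + Γ)⟩}

/-- Premises `A, (A ⇒ B), Γ` and `B, (A ⇒ B), Γ`, conclusion `(A ⇒ B), Γ`. -/
def MPCEMg (V : Type u) : Set (Rule V) :=
  {r | ∃ (A B : Form V) (Γ : Sequent V),
    r = ⟨[A ::ₘ A.cond B ::ₘ Γ, B ::ₘ A.cond B ::ₘ Γ], A.cond B ::ₘ Γ⟩}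

/-- The sequent rule set `L_g` associated with the extension of `CK` by the principles in `L`. -/
def sequentRules (V : Type u) (L : Finset Principle) : Set (Rule V) :=
  (if .CEM ∈ L then
    (if .ID ∈ L then CKCEMIDg V else CKCEMg V)
  else
    (if .ID ∈ L then CKIDg V else CKg V)) ∪
  (if .MP ∈ L then MPg V else ∅) ∪
  (if .MP ∈ L ∧ .CEM ∈ L then MPCEMg V else ∅)

end CondLogic

namespace CondLogic

open Form

universe u

variable {V : Type u} {L : Finset Principle}

/-! Sequents are replaced by sets of formulas, in a calculus whose propositional and `MP`-type rules
keep their principal formula in the premises, so that contraction is built in and weakening is an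
easy induction. One modal rule stands for all four modal schemas. The passage back to multisets,
`SetDerivable.gDerivable_of_covered`, proves more than equivalence: the target sequent need only
contain the pieces into which the formulas of the set decompose, which also yields inversion of the
propositional rules.

Cut is eliminated by an outer induction on a bound for the conditional rank of the cut formula and
of the whole context. The context must be bounded too, because comparing two modal inferences needs
provable equivalence of antecedents to be transitive, hence cuts on antecedents that may be
unrelated to the cut formula. All premises of a modal inference have smaller rank, so these cuts are
available. At a fixed bound one argues by structural induction on the cut formula. Negations and
conjunctions are treated by inversion. For the rest, the derivation of the left premise is followed
until the cut formula is principal (`SetDerivable.cut_left`), then that of the right premise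
(`SetDerivable.cut_right`).

If `C ⇒ D` is principal in two modal inferences, their last premises are brought to a common
reference antecedent (`SetDerivable.change_reference`) and `D` is cut at lower rank. If an `MP`-type
rule meets a modal one, `D` is cut at the same rank, which the structural induction permits; the
companions left over are discharged by the `MP`-type rules themselves
(`SetDerivable.remove_companions`).

With cut available, Hilbert derivations are simulated: tautologies by Kalmár's argument, modus
ponens by cut and inversion, the conditional rules and axioms by explicit derivations. -/

/-! ### The calculus on sets of formulas -/

/-- The formulas that may accompany `B₀` in the last premise of a modal rule with reference
antecedent `C`, if `S` is the conclusion and the conditionals with antecedent in `E` are active. -/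
def activeConsequents (L : Finset Principle) (E S : Set (Form V)) (C : Form V) : Set (Form V) :=
  {x | (.ID ∈ L ∧ x = C.neg) ∨ (∃ A B, A ∈ E ∧ x = B.neg ∧ (A.cond B).neg ∈ S) ∨
    (.CEM ∈ L ∧ ∃ A B, A ∈ E ∧ x = B ∧ A.cond B ∈ S)}

/-- A cumulative presentation of the sequent calculus in which sequents are sets of formulas. -/
inductive SetDerivable (L : Finset Principle) : Set (Form V) → Prop
  | ax (S : Set (Form V)) (A : Form V) : A ∈ S → A.neg ∈ S → SetDerivable L S
  | negBot (S : Set (Form V)) : bot.neg ∈ S → SetDerivable L S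
  | negConj (S : Set (Form V)) (A B : Form V) : (A.conj B).neg ∈ S →
      SetDerivable L (insert A.neg (insert B.neg S)) → SetDerivable L S
  | conj (S : Set (Form V)) (A B : Form V) : A.conj B ∈ S →
      SetDerivable L (insert A S) → SetDerivable L (insert B S) → SetDerivable L S
  | negNeg (S : Set (Form V)) (A : Form V) : A.neg.neg ∈ S →
      SetDerivable L (insert A S) → SetDerivable L S
  | modal (S : Set (Form V)) (A₀ B₀ : Form V) (E T : Set (Form V)) : A₀.cond B₀ ∈ S →
      (∀ A ∈ E, SetDerivable L {A₀.neg, A}) → (∀ A ∈ E, SetDerivable L {A.neg, A₀}) →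
      SetDerivable L T → T ⊆ insert B₀ (activeConsequents L E S A₀) → SetDerivable L S
  | mp (S : Set (Form V)) (A B : Form V) : .MP ∈ L → (A.cond B).neg ∈ S →
      SetDerivable L (insert A S) → SetDerivable L (insert B.neg S) → SetDerivable L S
  | mpcem (S : Set (Form V)) (A B : Form V) : .MP ∈ L → .CEM ∈ L → A.cond B ∈ S →
      SetDerivable L (insert A S) → SetDerivable L (insert B S) → SetDerivable L S

theorem activeConsequents_mono {E E' S S' : Set (Form V)} (hE : E ⊆ E') (hS : S ⊆ S')
    (C : Form V) : activeConsequents L E S C ⊆ activeConsequents L E' S' C := by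
  rintro x (h | ⟨A, B, hA, hx, hm⟩ | ⟨hc, A, B, hA, hx, hm⟩)
  · exact Or.inl h
  · exact Or.inr (Or.inl ⟨A, B, hE hA, hx, hS hm⟩)
  · exact Or.inr (Or.inr ⟨hc, A, B, hE hA, hx, hS hm⟩)

namespace SetDerivable

theorem weaken {S S' : Set (Form V)} (h : SetDerivable L S) (hS : S ⊆ S') :
    SetDerivable L S' := by
  induction h generalizing S' with
  | ax S A h1 h2 => exact ax _ A (hS h1) (hS h2)
  | negBot S h => exact negBot _ (hS h)
  | negConj S A B h _ ih =>
    exact negConj _ A B (hS h) (ih (Set.insert_subset_insert (Set.insert_subset_insert hS)))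
  | conj S A B h _ _ ih1 ih2 =>
    exact conj _ A B (hS h) (ih1 (Set.insert_subset_insert hS)) (ih2 (Set.insert_subset_insert hS))
  | negNeg S A h _ ih => exact negNeg _ A (hS h) (ih (Set.insert_subset_insert hS))
  | modal S A₀ B₀ E T h h1 h2 h3 h4 _ _ _ =>
    exact modal _ A₀ B₀ E T (hS h) h1 h2 h3
      (h4.trans (Set.insert_subset_insert (activeConsequents_mono subset_rfl hS A₀)))
  | mp S A B hL h _ _ ih1 ih2 =>
    exact mp _ A B hL (hS h) (ih1 (Set.insert_subset_insert hS)) (ih2 (Set.insert_subset_insert hS))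
  | mpcem S A B hL hL' h _ _ ih1 ih2 =>
    exact mpcem _ A B hL hL' (hS h) (ih1 (Set.insert_subset_insert hS))
      (ih2 (Set.insert_subset_insert hS))

end SetDerivable

/-! ### From multisets to sets -/

/-- The premise `¬A₀` of the rules for `ID`. -/
noncomputable def idPremise (L : Finset Principle) (A₀ : Form V) : Sequent V :=
  if .ID ∈ L then {A₀.neg} else 0

/-- Puts the four modal schemas into one form, so that later arguments need no case distinction on
`L`: without `CEM` the list `P` is forced to be empty, and `ID` only affects `idPremise`. -/
theorem mem_sequentRules {r : Rule V} : r ∈ sequentRules V L ↔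
    (∃ (A₀ B₀ : Form V) (P N : List (Form V × Form V)) (Γ : Sequent V), (P ≠ [] → .CEM ∈ L) ∧
      r = ⟨eqSequents A₀ ((P ++ N).map fun x => x.1) ++
        [idPremise L A₀ + (B₀ ::ₘ (posConsequents P + negConsequents N))],
      A₀.cond B₀ ::ₘ (posConds P + negConds N + Γ)⟩) ∨
    (.MP ∈ L ∧ r ∈ MPg V) ∨ (.MP ∈ L ∧ .CEM ∈ L ∧ r ∈ MPCEMg V) := by
  have h1 : r ∈ (if .CEM ∈ L then (if .ID ∈ L then CKCEMIDg V else CKCEMg V)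
      else (if .ID ∈ L then CKIDg V else CKg V)) ↔
      (∃ (A₀ B₀ : Form V) (P N : List (Form V × Form V)) (Γ : Sequent V), (P ≠ [] → .CEM ∈ L) ∧
      r = ⟨eqSequents A₀ ((P ++ N).map fun x => x.1) ++
        [idPremise L A₀ + (B₀ ::ₘ (posConsequents P + negConsequents N))],
      A₀.cond B₀ ::ₘ (posConds P + negConds N + Γ)⟩) := by
    unfold idPremise
    split_ifs with hC hI hI
    · simp [CKCEMIDg, hC, Multiset.cons_swap]
    · simp [CKCEMg, hC]
    · constructor
      · rintro ⟨A₀, B₀, N, Γ, rfl⟩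
        exact ⟨A₀, B₀, [], N, Γ, by simp, by simp [posConsequents, posConds, Multiset.cons_swap]⟩
      · rintro ⟨A₀, B₀, P, N, Γ, hP, rfl⟩
        obtain rfl : P = [] := by by_contra h; exact hC (hP h)
        exact ⟨A₀, B₀, N, Γ, by simp [posConsequents, posConds, Multiset.cons_swap]⟩
    · constructor
      · rintro ⟨A₀, B₀, N, Γ, rfl⟩
        exact ⟨A₀, B₀, [], N, Γ, by simp, by simp [posConsequents, posConds]⟩
      · rintro ⟨A₀, B₀, P, N, Γ, hP, rfl⟩
        obtain rfl : P = [] := by by_contra h; exact hC (hP h)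
        exact ⟨A₀, B₀, N, Γ, by simp [posConsequents, posConds]⟩
  rw [sequentRules, Set.mem_union, Set.mem_union, h1, or_assoc]
  refine or_congr Iff.rfl (or_congr ?_ ?_)
  · split_ifs with h <;> simp [h]
  · split_ifs with h
    · simp [h.1, h.2]
    · simp only [Set.mem_empty_iff_false, false_iff]
      tauto

theorem GDerivable.setDerivable {Γ : Sequent V} (h : GDerivable (sequentRules V L) Γ) :
    SetDerivable L {x | x ∈ Γ} := by
  induction h with
  | ax A Γ => exact .ax _ A (by simp) (by simp)
  | negBot Γ => exact .negBot _ (by simp)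
  | negConj A B Γ _ ih =>
    exact .negConj _ A B (by simp) (ih.weaken fun x => by simp; tauto)
  | conj A B Γ _ _ ih1 ih2 =>
    exact .conj _ A B (by simp) (ih1.weaken fun x => by simp; tauto)
      (ih2.weaken fun x => by simp; tauto)
  | negNeg A Γ _ ih => exact .negNeg _ A (by simp) (ih.weaken fun x => by simp; tauto)
  | rule r hr _ ih =>
    rcases mem_sequentRules.1 hr with ⟨A₀, B₀, P, N, Γ, hP, rfl⟩ | ⟨hM, A, B, Γ, rfl⟩ |
      ⟨hM, hC, A, B, Γ, rfl⟩
    · refine .modal _ A₀ B₀ {A | A ∈ (P ++ N).map fun x => x.1}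
        {x | x ∈ idPremise L A₀ + (B₀ ::ₘ (posConsequents P + negConsequents N))} (by simp) ?_ ?_
        (ih _ (by simp)) ?_
      · intro A hA
        refine (ih {A₀.neg, A} ?_).weaken fun x => by simp
        simp only [eqSequents, List.mem_append, List.mem_flatMap]
        exact Or.inl ⟨A, hA, by simp⟩
      · intro A hA
        refine (ih {A.neg, A₀} ?_).weaken fun x => by simp
        simp only [eqSequents, List.mem_append, List.mem_flatMap]
        exact Or.inl ⟨A, hA, by simp⟩
      · intro x hx
        simp only [Set.mem_ofPred_eq, Multiset.mem_add, Multiset.mem_cons] at hx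
        rcases hx with hx | rfl | hx | hx
        · unfold idPremise at hx
          split_ifs at hx with hI
          · exact Or.inr (Or.inl ⟨hI, by simpa using hx⟩)
          · simp at hx
        · exact Or.inl rfl
        · simp only [posConsequents, Multiset.mem_coe, List.mem_map] at hx
          obtain ⟨p, hp, rfl⟩ := hx
          refine Or.inr (Or.inr (Or.inr ⟨hP (List.ne_nil_of_mem hp), p.1, p.2, ?_, rfl, ?_⟩))
          · exact List.mem_map.2 ⟨p, by simp [hp], rfl⟩
          · simp only [Set.mem_ofPred_eq, Multiset.mem_add, Multiset.mem_cons]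
            exact Or.inr (Or.inl (Or.inl (List.mem_map.2 ⟨p, hp, rfl⟩)))
        · simp only [negConsequents, Multiset.mem_coe, List.mem_map] at hx
          obtain ⟨p, hp, rfl⟩ := hx
          refine Or.inr (Or.inr (Or.inl ⟨p.1, p.2, ?_, rfl, ?_⟩))
          · exact List.mem_map.2 ⟨p, by simp [hp], rfl⟩
          · simp only [Set.mem_ofPred_eq, Multiset.mem_add, Multiset.mem_cons]
            exact Or.inr (Or.inl (Or.inr (List.mem_map.2 ⟨p, hp, rfl⟩)))
    · exact .mp _ A B hM (by simp) ((ih _ (List.mem_cons_self)).weaken fun x => by simp)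
        ((ih (B.neg ::ₘ (A.cond B).neg ::ₘ Γ) (by simp)).weaken fun x => by simp)
    · exact .mpcem _ A B hM hC (by simp) ((ih _ (List.mem_cons_self)).weaken fun x => by simp)
        ((ih (B ::ₘ A.cond B ::ₘ Γ) (by simp)).weaken fun x => by simp)

/-! ### From sets back to multisets, with contraction and inversion -/

/-- `x` decomposes, by inverting propositional rules along one branch, into members of `Δ`. -/
inductive Covered (Δ : Sequent V) : Form V → Prop
  | mem (x : Form V) : x ∈ Δ → Covered Δ x
  | conjLeft (A B : Form V) : Covered Δ A → Covered Δ (A.conj B)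
  | conjRight (A B : Form V) : Covered Δ B → Covered Δ (A.conj B)
  | negConj (A B : Form V) : Covered Δ A.neg → Covered Δ B.neg → Covered Δ (A.conj B).neg
  | negNeg (A : Form V) : Covered Δ A → Covered Δ A.neg.neg

theorem Covered.trans {Δ Δ' : Sequent V} {x : Form V} (h : Covered Δ x)
    (hΔ : ∀ y ∈ Δ, Covered Δ' y) : Covered Δ' x := by
  induction h with
  | mem x hx => exact hΔ x hx
  | conjLeft A B _ ih => exact .conjLeft A B ih
  | conjRight A B _ ih => exact .conjRight A B ih
  | negConj A B _ _ ih1 ih2 => exact .negConj A B ih1 ih2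
  | negNeg A _ ih => exact .negNeg A ih

/-- Used when a principal formula `y` is consumed by a multiset rule: its components in `Δ'` still
cover everything that `y` covered. -/
theorem Covered.of_cons {Δ Δ' : Sequent V} {x y : Form V} (h : Covered (y ::ₘ Δ) x)
    (hy : Covered Δ' y) (hΔ : Δ ≤ Δ') : Covered Δ' x := by
  refine h.trans fun z hz => ?_
  rcases Multiset.mem_cons.1 hz with rfl | hz
  · exact hy
  · exact .mem _ (Multiset.mem_of_le hΔ hz)

/-- Axioms survive decomposition. In the induction on `A`, either both decompositions meet in a
smaller complementary pair, or an undecomposed formula in `Δ` is broken up by its own rule. -/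
theorem GDerivable.of_covered_neg {R : Set (Rule V)} (A : Form V) {Δ : Sequent V}
    (h : Covered Δ A) (h' : Covered Δ A.neg) : GDerivable R Δ := by
  induction A generalizing Δ with
  | bot =>
    cases h' with | mem _ h' =>
    obtain ⟨Δ, rfl⟩ := Multiset.exists_cons_of_mem h'
    exact .negBot Δ
  | var p =>
    cases h with | mem _ h =>
    cases h' with | mem _ h' =>
    obtain ⟨Δ, rfl⟩ := Multiset.exists_cons_of_mem h
    obtain ⟨Δ, rfl⟩ := Multiset.exists_cons_of_mem ((Multiset.mem_cons.1 h').resolve_left (by simp))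
    exact .ax _ Δ
  | cond A B _ _ =>
    cases h with | mem _ h =>
    cases h' with | mem _ h' =>
    obtain ⟨Δ, rfl⟩ := Multiset.exists_cons_of_mem h
    obtain ⟨Δ, rfl⟩ := Multiset.exists_cons_of_mem ((Multiset.mem_cons.1 h').resolve_left (by simp))
    exact .ax _ Δ
  | neg A ih =>
    cases h' with
    | negNeg _ h' => exact ih h' h
    | mem _ h' =>
      obtain ⟨Δ, rfl⟩ := Multiset.exists_cons_of_mem h'
      have hA : Covered (A ::ₘ Δ) A := .mem _ (by simp)
      exact .negNeg A Δ (ih hA (h.of_cons (.negNeg A hA) (Multiset.le_cons_self _ _)))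
  | conj A B ihA ihB =>
    cases h with
    | mem _ h =>
      obtain ⟨Δ, rfl⟩ := Multiset.exists_cons_of_mem h
      have hA : Covered (A ::ₘ Δ) A := .mem _ (by simp)
      have hB : Covered (B ::ₘ Δ) B := .mem _ (by simp)
      cases h' with
      | negConj _ _ h1 h2 =>
        exact .conj A B Δ (ihA hA (h1.of_cons (.conjLeft _ _ hA) (Multiset.le_cons_self _ _)))
          (ihB hB (h2.of_cons (.conjRight _ _ hB) (Multiset.le_cons_self _ _)))
      | mem _ h' =>
        obtain ⟨Δ, rfl⟩ :=
          Multiset.exists_cons_of_mem ((Multiset.mem_cons.1 h').resolve_left (by simp))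
        exact .ax _ Δ
    | conjLeft _ _ h =>
      cases h' with
      | negConj _ _ h1 h2 => exact ihA h h1
      | mem _ h' =>
        obtain ⟨Δ, rfl⟩ := Multiset.exists_cons_of_mem h'
        have hA : Covered (A.neg ::ₘ B.neg ::ₘ Δ) A.neg := .mem _ (by simp)
        refine .negConj A B Δ (ihA (h.of_cons (.negConj _ _ hA (.mem _ (by simp))) ?_) hA)
        exact (Multiset.le_cons_self _ _).trans (Multiset.le_cons_self _ _)
    | conjRight _ _ h =>
      cases h' with
      | negConj _ _ h1 h2 => exact ihB h h2
      | mem _ h' =>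
        obtain ⟨Δ, rfl⟩ := Multiset.exists_cons_of_mem h'
        have hB : Covered (A.neg ::ₘ B.neg ::ₘ Δ) B.neg := .mem _ (by simp)
        refine .negConj A B Δ (ihB (h.of_cons (.negConj _ _ (.mem _ (by simp)) hB) ?_) hB)
        exact (Multiset.le_cons_self _ _).trans (Multiset.le_cons_self _ _)

theorem finite_posPairs {S : Set (Form V)} (hS : S.Finite) :
    {p : Form V × Form V | p.1.cond p.2 ∈ S}.Finite :=
  hS.preimage (f := fun p : Form V × Form V => p.1.cond p.2)
    (fun p _ q _ h => by simpa [Prod.ext_iff] using h)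

theorem finite_negPairs {S : Set (Form V)} (hS : S.Finite) :
    {p : Form V × Form V | (p.1.cond p.2).neg ∈ S}.Finite :=
  hS.preimage (f := fun p : Form V × Form V => (p.1.cond p.2).neg)
    (fun p _ q _ h => by simpa [Prod.ext_iff] using h)

/-- The sets `E` and `T` may be infinite, but only finitely many conditionals occur in `Δ`. Listing
all active ones without repetition gives an instance of the multiset rule. -/
theorem GDerivable.modal {Δ : Sequent V} {A₀ B₀ : Form V} {E T : Set (Form V)}
    (h₀ : A₀.cond B₀ ∈ Δ) (h1 : ∀ A ∈ E, GDerivable (sequentRules V L) {A₀.neg, A})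
    (h2 : ∀ A ∈ E, GDerivable (sequentRules V L) {A.neg, A₀})
    (h3 : ∀ Γ : Sequent V, (∀ x ∈ T, x ∈ Γ) → GDerivable (sequentRules V L) Γ)
    (hT : T ⊆ insert B₀ (activeConsequents L E {x | x ∈ Δ} A₀)) :
    GDerivable (sequentRules V L) Δ := by
  classical
  have hfin : {x | x ∈ Δ}.Finite := Δ.finite_toSet
  -- The pair `(A₀, B₀)` is excluded because `Δ` may contain only one copy of `A₀ ⇒ B₀`, already
  -- used as principal formula.
  have hPfin : {p : Form V × Form V | .CEM ∈ L ∧ p ≠ (A₀, B₀) ∧ p.1 ∈ E ∧ p.1.cond p.2 ∈ Δ}.Finite :=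
    (finite_posPairs hfin).subset fun p hp => hp.2.2.2
  have hNfin : {p : Form V × Form V | p.1 ∈ E ∧ (p.1.cond p.2).neg ∈ Δ}.Finite :=
    (finite_negPairs hfin).subset fun p hp => hp.2
  obtain ⟨P, hPn, hP⟩ : ∃ P : List (Form V × Form V), P.Nodup ∧
      ∀ p, p ∈ P ↔ .CEM ∈ L ∧ p ≠ (A₀, B₀) ∧ p.1 ∈ E ∧ p.1.cond p.2 ∈ Δ :=
    ⟨hPfin.toFinset.toList, Finset.nodup_toList _, by simp⟩
  obtain ⟨N, hNn, hN⟩ : ∃ N : List (Form V × Form V), N.Nodup ∧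
      ∀ p, p ∈ N ↔ p.1 ∈ E ∧ (p.1.cond p.2).neg ∈ Δ :=
    ⟨hNfin.toFinset.toList, Finset.nodup_toList _, by simp⟩
  -- Since the principal formulas are pairwise distinct, membership in `Δ` suffices for multiset
  -- inclusion.
  have hle : A₀.cond B₀ ::ₘ (posConds P + negConds N) ≤ Δ := by
    refine (Multiset.le_iff_subset ?_).2 ?_
    · rw [Multiset.nodup_cons, Multiset.nodup_add]
      refine ⟨?_, ?_, ?_, ?_⟩
      · simp only [posConds, negConds, Multiset.mem_add, Multiset.mem_coe, List.mem_map]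
        rintro (⟨p, hp, hpe⟩ | ⟨p, hp, hpe⟩)
        · simp only [cond.injEq] at hpe
          exact ((hP p).1 hp).2.1 (Prod.ext hpe.1 hpe.2)
        · simp at hpe
      · exact Multiset.coe_nodup.2 (hPn.map fun p q h => by simpa [Prod.ext_iff] using h)
      · exact Multiset.coe_nodup.2 (hNn.map fun p q h => by simpa [Prod.ext_iff] using h)
      · rw [Multiset.disjoint_left]
        simp only [posConds, negConds, Multiset.mem_coe, List.mem_map]
        rintro x ⟨p, _, rfl⟩ ⟨q, _, hq⟩
        simp at hq
    · intro x hx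
      simp only [posConds, negConds, Multiset.mem_cons, Multiset.mem_add, Multiset.mem_coe,
        List.mem_map] at hx
      rcases hx with rfl | ⟨p, hp, rfl⟩ | ⟨p, hp, rfl⟩
      · exact h₀
      · exact ((hP p).1 hp).2.2.2
      · exact ((hN p).1 hp).2
  obtain ⟨Γ, rfl⟩ := Multiset.le_iff_exists_add.1 hle
  rw [Multiset.cons_add]
  refine GDerivable.rule _ (mem_sequentRules.2 (Or.inl ⟨A₀, B₀, P, N, Γ, ?_, rfl⟩)) ?_
  · intro hne
    obtain ⟨p, hp⟩ := List.exists_mem_of_ne_nil _ hne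
    exact ((hP p).1 hp).1
  · intro Θ hΘ
    simp only [eqSequents, List.mem_append, List.mem_flatMap, List.mem_map, List.mem_cons,
      List.not_mem_nil, or_false] at hΘ
    rcases hΘ with ⟨A, ⟨p, hp, rfl⟩, rfl | rfl⟩ | rfl
    · exact h1 _ (hp.elim (fun hp => ((hP p).1 hp).2.2.1) fun hp => ((hN p).1 hp).1)
    · exact h2 _ (hp.elim (fun hp => ((hP p).1 hp).2.2.1) fun hp => ((hN p).1 hp).1)
    · refine h3 _ fun x hx => ?_
      simp only [Multiset.mem_add, Multiset.mem_cons, posConsequents, negConsequents,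
        Multiset.mem_coe, List.mem_map]
      rcases hT hx with rfl | ⟨hI, rfl⟩ | ⟨A, B, hA, rfl, hm⟩ | ⟨hC, A, B, hA, rfl, hm⟩
      · exact Or.inr (Or.inl rfl)
      · exact Or.inl (by simp [idPremise, hI])
      · exact Or.inr (Or.inr (Or.inr ⟨(A, B), (hN _).2 ⟨hA, hm⟩, rfl⟩))
      · by_cases he : (A, x) = (A₀, B₀)
        · exact Or.inr (Or.inl (Prod.ext_iff.1 he).2)
        · exact Or.inr (Or.inr (Or.inl ⟨(A, x), (hP _).2 ⟨hC, he, hA, hm⟩, rfl⟩))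

/-- If a principal formula is in `Δ`, the multiset rule is applied and the consumed formula stays
covered by its components. If it is covered only through decomposition, the inference is skipped and
one premise is used for the same `Δ`. -/
theorem SetDerivable.gDerivable_of_covered {S : Set (Form V)} (h : SetDerivable L S)
    {Δ : Sequent V} (hS : ∀ x ∈ S, Covered Δ x) : GDerivable (sequentRules V L) Δ := by
  have key : ∀ {Δ Δ' : Sequent V} {y : Form V} {S : Set (Form V)}, (∀ x ∈ S, Covered (y ::ₘ Δ) x) →
      Covered Δ' y → Δ ≤ Δ' → ∀ x ∈ S, Covered Δ' x :=
    fun h hy hΔ x hx => (h x hx).of_cons hy hΔ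
  have ins : ∀ {Δ : Sequent V} {y : Form V} {S : Set (Form V)}, Covered Δ y →
      (∀ x ∈ S, Covered Δ x) → ∀ x ∈ insert y S, Covered Δ x := by
    rintro Δ y S hy hS x (rfl | hx)
    · exact hy
    · exact hS x hx
  induction h generalizing Δ with
  | ax S A h h' => exact .of_covered_neg A (hS _ h) (hS _ h')
  | negBot S h =>
    cases hS _ h with | mem _ h =>
    obtain ⟨Δ, rfl⟩ := Multiset.exists_cons_of_mem h
    exact .negBot Δ
  | negConj S A B h _ ih =>
    cases hS _ h with
    | negConj _ _ h1 h2 => exact ih (ins h1 (ins h2 hS))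
    | mem _ h =>
      obtain ⟨Δ, rfl⟩ := Multiset.exists_cons_of_mem h
      have hA : Covered (A.neg ::ₘ B.neg ::ₘ Δ) A.neg := .mem _ (by simp)
      have hB : Covered (A.neg ::ₘ B.neg ::ₘ Δ) B.neg := .mem _ (by simp)
      exact .negConj A B Δ (ih (ins hA (ins hB (key hS (.negConj _ _ hA hB)
        ((Multiset.le_cons_self _ _).trans (Multiset.le_cons_self _ _))))))
  | conj S A B h _ _ ih1 ih2 =>
    cases hS _ h with
    | conjLeft _ _ h => exact ih1 (ins h hS)
    | conjRight _ _ h => exact ih2 (ins h hS)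
    | mem _ h =>
      obtain ⟨Δ, rfl⟩ := Multiset.exists_cons_of_mem h
      have hA : Covered (A ::ₘ Δ) A := .mem _ (by simp)
      have hB : Covered (B ::ₘ Δ) B := .mem _ (by simp)
      exact .conj A B Δ (ih1 (ins hA (key hS (.conjLeft _ _ hA) (Multiset.le_cons_self _ _))))
        (ih2 (ins hB (key hS (.conjRight _ _ hB) (Multiset.le_cons_self _ _))))
  | negNeg S A h _ ih =>
    cases hS _ h with
    | negNeg _ h => exact ih (ins h hS)
    | mem _ h =>
      obtain ⟨Δ, rfl⟩ := Multiset.exists_cons_of_mem h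
      have hA : Covered (A ::ₘ Δ) A := .mem _ (by simp)
      exact .negNeg A Δ (ih (ins hA (key hS (.negNeg _ hA) (Multiset.le_cons_self _ _))))
  | modal S A₀ B₀ E T h _ _ _ hT ih1 ih2 ih3 =>
    -- Conditionals and their negations do not decompose, so they are covered only by being members
    -- of `Δ`.
    have pos : ∀ A B : Form V, A.cond B ∈ S → A.cond B ∈ Δ := by
      intro A B hm
      cases hS _ hm with | mem _ h => exact h
    have neg : ∀ A B : Form V, (A.cond B).neg ∈ S → (A.cond B).neg ∈ Δ := by
      intro A B hm
      cases hS _ hm with | mem _ h => exact h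
    refine .modal (pos _ _ h) (fun A hA => ih1 A hA fun x hx => .mem _ (by simpa using hx))
      (fun A hA => ih2 A hA fun x hx => .mem _ (by simpa using hx))
      (fun Γ hΓ => ih3 fun x hx => .mem _ (hΓ x hx)) fun x hx => ?_
    rcases hT hx with hx | hx | ⟨A, B, hA, hx, hm⟩ | ⟨hC, A, B, hA, hx, hm⟩
    · exact Or.inl hx
    · exact Or.inr (Or.inl hx)
    · exact Or.inr (Or.inr (Or.inl ⟨A, B, hA, hx, neg _ _ hm⟩))
    · exact Or.inr (Or.inr (Or.inr ⟨hC, A, B, hA, hx, pos _ _ hm⟩))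
  | mp S A B hM h _ _ ih1 ih2 =>
    cases hS _ h with | mem _ h =>
    obtain ⟨Δ, rfl⟩ := Multiset.exists_cons_of_mem h
    refine .rule _ (mem_sequentRules.2 (Or.inr (Or.inl ⟨hM, A, B, Δ, rfl⟩))) fun Γ hΓ => ?_
    have hw : ∀ z, ∀ x ∈ S, Covered (z ::ₘ (A.cond B).neg ::ₘ Δ) x := fun z => key hS
      (.mem _ (by simp)) ((Multiset.le_cons_self _ _).trans (Multiset.le_cons_self _ _))
    simp only [List.mem_cons, List.not_mem_nil, or_false] at hΓ
    rcases hΓ with rfl | rfl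
    · exact ih1 (ins (.mem _ (by simp)) (hw _))
    · exact ih2 (ins (.mem _ (by simp)) (hw _))
  | mpcem S A B hM hC h _ _ ih1 ih2 =>
    cases hS _ h with | mem _ h =>
    obtain ⟨Δ, rfl⟩ := Multiset.exists_cons_of_mem h
    refine .rule _ (mem_sequentRules.2 (Or.inr (Or.inr ⟨hM, hC, A, B, Δ, rfl⟩))) fun Γ hΓ => ?_
    have hw : ∀ z, ∀ x ∈ S, Covered (z ::ₘ A.cond B ::ₘ Δ) x := fun z => key hS
      (.mem _ (by simp)) ((Multiset.le_cons_self _ _).trans (Multiset.le_cons_self _ _))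
    simp only [List.mem_cons, List.not_mem_nil, or_false] at hΓ
    rcases hΓ with rfl | rfl
    · exact ih1 (ins (.mem _ (by simp)) (hw _))
    · exact ih2 (ins (.mem _ (by simp)) (hw _))

theorem gDerivable_iff_setDerivable {Γ : Sequent V} :
    GDerivable (sequentRules V L) Γ ↔ SetDerivable L {x | x ∈ Γ} :=
  ⟨GDerivable.setDerivable, fun h => h.gDerivable_of_covered fun x hx => .mem x hx⟩


/-! ### Conditional rank and equivalence of antecedents -/

/-- The nesting depth of conditionals. -/
def Form.condRank : Form V → ℕ
  | bot => 0
  | var _ => 0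
  | neg A => condRank A
  | conj A B => max (condRank A) (condRank B)
  | cond A B => max (condRank A) (condRank B) + 1

/-- Finite sets of formulas of conditional rank below `n`. -/
def RankBelow (n : ℕ) (S : Set (Form V)) : Prop :=
  S.Finite ∧ ∀ x ∈ S, x.condRank < n

theorem RankBelow.lt_of_neg {n : ℕ} {S : Set (Form V)} {A : Form V} (hS : RankBelow n S)
    (hA : A.neg ∈ S) : A.condRank < n :=
  hS.2 A.neg hA

theorem RankBelow.insert {n : ℕ} {S : Set (Form V)} {A : Form V} (hS : RankBelow n S)
    (hA : A.condRank < n) : RankBelow n (insert A S) :=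
  ⟨hS.1.insert A, by rintro x (rfl | hx); exacts [hA, hS.2 x hx]⟩

theorem RankBelow.union {n : ℕ} {S T : Set (Form V)} (hS : RankBelow n S)
    (hT : RankBelow n T) : RankBelow n (S ∪ T) :=
  ⟨hS.1.union hT.1, fun x hx => hx.elim (hS.2 x) (hT.2 x)⟩

theorem RankBelow.mono {n m : ℕ} {S T : Set (Form V)} (hS : RankBelow n S) (hT : T ⊆ S)
    (hnm : n ≤ m) : RankBelow m T :=
  ⟨hS.1.subset hT, fun x hx => (hS.2 x (hT hx)).trans_le hnm⟩

theorem Form.condRank_lt_of_cond {n : ℕ} {A B : Form V} (h : (A.cond B).condRank < n + 1) :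
    A.condRank < n ∧ B.condRank < n := by
  simp only [condRank] at h
  omega

/-- The formulas provably equivalent to `C` in the cumulative calculus. -/
def equivalents (L : Finset Principle) (C : Form V) : Set (Form V) :=
  {A | SetDerivable L {C.neg, A} ∧ SetDerivable L {A.neg, C}}

/-- The formulas that may accompany the consequent in the last premise of a modal rule with
reference antecedent `C` and conclusion `S`. -/
def companions (L : Finset Principle) (S : Set (Form V)) (C : Form V) : Set (Form V) :=
  activeConsequents L (equivalents L C) S C

theorem companions_mono {S S' : Set (Form V)} (h : S ⊆ S') (C : Form V) :
    companions L S C ⊆ companions L S' C :=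
  activeConsequents_mono subset_rfl h C

theorem finite_companions {S : Set (Form V)} (hS : S.Finite) (C : Form V) :
    (companions L S C).Finite := by
  refine ((Set.finite_singleton C.neg).union (((finite_negPairs hS).image fun p => p.2.neg).union
    ((finite_posPairs hS).image fun p => p.2))).subset ?_
  rintro x (⟨_, rfl⟩ | ⟨A, B, _, rfl, hm⟩ | ⟨_, A, B, _, rfl, hm⟩)
  · exact Or.inl rfl
  · exact Or.inr (Or.inl ⟨(A, B), hm, rfl⟩)
  · exact Or.inr (Or.inr ⟨(A, x), hm, rfl⟩)

theorem RankBelow.companions {n : ℕ} {S : Set (Form V)} (hS : RankBelow (n + 1) S) {C : Form V}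
    (hC : C.condRank < n) : RankBelow n (companions L S C) := by
  refine ⟨finite_companions hS.1 C, ?_⟩
  rintro x (⟨_, rfl⟩ | ⟨A, B, _, rfl, hm⟩ | ⟨_, A, B, _, rfl, hm⟩)
  · exact hC
  · exact (condRank_lt_of_cond (hS.lt_of_neg hm)).2
  · exact (condRank_lt_of_cond (hS.2 _ hm)).2

theorem mem_equivalents_self (C : Form V) : C ∈ equivalents L C :=
  ⟨.ax _ C (by simp) (by simp), .ax _ C (by simp) (by simp)⟩

theorem mem_equivalents_symm {A C : Form V} (h : A ∈ equivalents L C) : C ∈ equivalents L A :=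
  ⟨h.2, h.1⟩

/-- The modal rule in its strongest form: every provably equivalent antecedent is active and every
admissible companion is present. -/
theorem SetDerivable.of_companions {S : Set (Form V)} {A B : Form V} (h : A.cond B ∈ S)
    (h' : SetDerivable L (insert B (companions L S A))) : SetDerivable L S :=
  .modal S A B (equivalents L A) _ h (fun _ hA => hA.1) (fun _ hA => hA.2) h' subset_rfl

/-- Cut on `A` holds for finite contexts of conditional rank below `n`. -/
def CutBelow (L : Finset Principle) (n : ℕ) (A : Form V) : Prop :=
  ∀ S : Set (Form V), RankBelow n S → SetDerivable L (insert A S) →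
    SetDerivable L (insert A.neg S) → SetDerivable L S

/-- Transitivity is a cut on the middle antecedent, in a context of two antecedents; this is why the
rank bound must cover contexts. -/
theorem equivalents_trans {n : ℕ} (hcut : ∀ A : Form V, A.condRank < n → CutBelow L n A)
    {A B C : Form V} (hA : A.condRank < n) (hB : B.condRank < n) (hC : C.condRank < n)
    (h : B ∈ equivalents L A) (h' : C ∈ equivalents L B) : C ∈ equivalents L A := by
  have key : ∀ A B C : Form V, A.condRank < n → B.condRank < n → C.condRank < n →
      SetDerivable L {A.neg, B} → SetDerivable L {B.neg, C} → SetDerivable L {A.neg, C} := by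
    intro A B C hA hB hC h h'
    refine hcut B hB _ ⟨Set.toFinite _, ?_⟩ (h.weaken fun x => by simp; tauto)
      (h'.weaken fun x => by simp; tauto)
    rintro x (rfl | rfl)
    exacts [hA, hC]
  exact ⟨key _ _ _ hA hB hC h.1 h'.1, key _ _ _ hC hB hA h'.2 h.2⟩

/-! ### Changing the reference antecedent and removing companions -/

/-- Change of the reference antecedent in the last premise of a modal rule. -/
theorem SetDerivable.change_reference {n : ℕ}
    (hcut : ∀ A : Form V, A.condRank < n → CutBelow L n A) {S Y : Set (Form V)} {A C : Form V}
    (hS : RankBelow (n + 1) S) (hY : RankBelow n Y) (hA : A.condRank < n) (hC : C.condRank < n)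
    (hAC : A ∈ equivalents L C) (h : SetDerivable L (Y ∪ companions L S A)) :
    SetDerivable L (Y ∪ companions L S C) := by
  -- Consequents carry over by transitivity of equivalence; only `¬A`, present under `ID`, can be
  -- lost.
  have hsub : companions L S A ⊆ {x | .ID ∈ L ∧ x = A.neg} ∪ companions L S C := by
    rintro x (h | ⟨A', B, hA', rfl, hm⟩ | ⟨hc, A', B, hA', rfl, hm⟩)
    · exact Or.inl h
    · exact Or.inr (Or.inr (Or.inl ⟨A', B, equivalents_trans hcut hC hA
        (condRank_lt_of_cond (hS.lt_of_neg hm)).1 hAC hA', rfl, hm⟩))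
    · exact Or.inr (Or.inr (Or.inr ⟨hc, A', x, equivalents_trans hcut hC hA
        (condRank_lt_of_cond (hS.2 _ hm)).1 hAC hA', rfl, hm⟩))
  by_cases hI : .ID ∈ L
  -- Cutting `¬A` against `¬C, A` replaces it by `¬C`, which is itself a companion for `C`.
  · refine hcut A hA _ (hY.union (hS.companions hC)) (hAC.1.weaken ?_) (h.weaken ?_)
    · rintro x (rfl | rfl)
      · exact Or.inr (Or.inr (Or.inl ⟨hI, rfl⟩))
      · exact Or.inl rfl
    · rintro x (hx | hx)
      · exact Or.inr (Or.inl hx)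
      · rcases hsub hx with ⟨_, hx⟩ | hx
        · exact Or.inl hx
        · exact Or.inr (Or.inr hx)
  · refine h.weaken (Set.union_subset_union_right _ fun x hx => ?_)
    exact (hsub hx).resolve_left fun h => hI h.1

/-- In the presence of conditional modus ponens, companions of a derivable antecedent `C` can be
removed. -/
theorem SetDerivable.remove_companions {n : ℕ} (hM : .MP ∈ L) {S : Set (Form V)} {C : Form V}
    (hcut : CutBelow L (n + 1) C) (hS : RankBelow (n + 1) S) (hC : C.condRank < n)
    (h : SetDerivable L (insert C S)) (h' : SetDerivable L (S ∪ companions L S C)) :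
    SetDerivable L S := by
  -- Each kind of companion has its own removal: `¬C` by cut on `C`, a negated consequent by the
  -- `MP` rule, a positive one by the `MPCEM` rule. The premise with antecedent `A` comes from `C`
  -- by cutting with `¬C, A`.
  have key : ∀ x ∈ companions L S C, ∀ S', S ⊆ S' → RankBelow (n + 1) S' →
      SetDerivable L (insert x S') → SetDerivable L S' := by
    intro x hx S' hSS hS' hd
    have hC' : SetDerivable L (insert C S') := h.weaken (Set.insert_subset_insert hSS)
    have tr : ∀ {A B : Form V}, (A.cond B ∈ S ∨ (A.cond B).neg ∈ S) → A ∈ equivalents L C →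
        SetDerivable L (insert A S') := by
      intro A B hm hA
      have hAr : A.condRank < n := by
        rcases hm with hm | hm
        · exact (condRank_lt_of_cond (hS.2 _ hm)).1
        · exact (condRank_lt_of_cond (hS.lt_of_neg hm)).1
      refine hcut _ (hS'.insert (hAr.trans (Nat.lt_succ_self n))) (hC'.weaken ?_) (hA.1.weaken ?_)
      · exact Set.insert_subset_insert (Set.subset_insert _ _)
      · rintro x (rfl | rfl)
        · exact Or.inl rfl
        · exact Or.inr (Or.inl rfl)
    rcases hx with ⟨_, rfl⟩ | ⟨A, B, hA, rfl, hm⟩ | ⟨hc, A, B, hA, rfl, hm⟩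
    · exact hcut S' hS' hC' hd
    · exact .mp S' A B hM (hSS hm) (tr (Or.inr hm) hA) hd
    · exact .mpcem S' A x hM hc (hSS hm) (tr (Or.inl hm) hA) hd
  have hrank : RankBelow (n + 1) (companions L S C) :=
    (hS.companions hC).mono subset_rfl n.le_succ
  have ind : ∀ F : Set (Form V), F.Finite → F ⊆ companions L S C →
      SetDerivable L (S ∪ F) → SetDerivable L S := by
    intro F hF
    induction F, hF using Set.Finite.induction_on with
    | empty => intro _ h; simpa using h
    | @insert x F _ _ ih =>
      intro hsub hd
      have hF : F ⊆ companions L S C := (Set.subset_insert _ _).trans hsub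
      refine ih hF (key x (hsub (Set.mem_insert _ _)) _ Set.subset_union_left
        (hS.union (hrank.mono hF le_rfl)) ?_)
      rwa [← Set.union_insert]
  exact ind _ hrank.1 subset_rfl h'

/-- Inversion comes from a round trip through multisets, where formulas of `S` need only be covered
by `T`. -/
theorem SetDerivable.invert {S T : Set (Form V)} (h : SetDerivable L S) (hT : T.Finite)
    (hST : ∀ x ∈ S, Covered hT.toFinset.val x) : SetDerivable L T :=
  (h.gDerivable_of_covered hST).setDerivable.weaken fun x hx => by simpa using hx

theorem SetDerivable.invert_insert {S T : Set (Form V)} {A : Form V}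
    (h : SetDerivable L (insert A S)) (hT : T.Finite) (hA : Covered hT.toFinset.val A)
    (hST : S ⊆ T) : SetDerivable L T := by
  refine h.invert hT ?_
  rintro x (rfl | hx)
  · exact hA
  · exact .mem _ (by simpa using hST hx)

theorem SetDerivable.invert_conj {S : Set (Form V)} {A B : Form V} (hS : S.Finite)
    (h : SetDerivable L (insert (A.conj B) S)) :
    SetDerivable L (insert A S) ∧ SetDerivable L (insert B S) :=
  ⟨h.invert_insert (hS.insert A) (.conjLeft _ _ (.mem _ (by simp))) (Set.subset_insert _ _),
    h.invert_insert (hS.insert B) (.conjRight _ _ (.mem _ (by simp))) (Set.subset_insert _ _)⟩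

theorem SetDerivable.invert_negConj {S : Set (Form V)} {A B : Form V} (hS : S.Finite)
    (h : SetDerivable L (insert (A.conj B).neg S)) :
    SetDerivable L (insert A.neg (insert B.neg S)) :=
  h.invert_insert ((hS.insert B.neg).insert A.neg)
    (.negConj _ _ (.mem _ (by simp)) (.mem _ (by simp)))
    ((Set.subset_insert _ _).trans (Set.subset_insert _ _))

theorem SetDerivable.invert_negNeg {S : Set (Form V)} {A : Form V} (hS : S.Finite)
    (h : SetDerivable L (insert A.neg.neg S)) : SetDerivable L (insert A S) :=
  h.invert_insert (hS.insert A) (.negNeg _ (.mem _ (by simp))) (Set.subset_insert _ _)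

theorem insert_subset_insert_insert {α : Type*} {x a : α} {R S : Set α}
    (h : R ⊆ insert a S) : insert x R ⊆ insert a (insert x S) := by
  rw [Set.insert_comm]
  exact Set.insert_subset_insert h

/-! ### Cut elimination -/

/-- Induction on the left premise of a cut whose cut formula is a variable, `⊥` or a conditional. -/
theorem SetDerivable.cut_left {n : ℕ} (hcut : ∀ A : Form V, A.condRank < n → CutBelow L n A)
    {X : Form V} (hXn : ∀ A : Form V, X ≠ A.neg) (hXc : ∀ A B : Form V, X ≠ A.conj B)
    (hX : X.condRank < n + 1)
    (hmodal : ∀ (S : Set (Form V)) (C D : Form V), X = C.cond D → RankBelow (n + 1) S →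
      SetDerivable L (insert D (companions L S C)) → SetDerivable L (insert X.neg S) →
      SetDerivable L S)
    (hmpcem : ∀ (S : Set (Form V)) (C D : Form V), X = C.cond D → RankBelow (n + 1) S →
      .MP ∈ L → .CEM ∈ L → SetDerivable L (insert C S) → SetDerivable L (insert D S) →
      SetDerivable L (insert X.neg S) → SetDerivable L S)
    {R : Set (Form V)} (h : SetDerivable L R) {S : Set (Form V)} (hS : RankBelow (n + 1) S)
    (hR : R ⊆ insert X S) (h' : SetDerivable L (insert X.neg S)) : SetDerivable L S := by
  have wk : ∀ {S : Set (Form V)} (A : Form V), SetDerivable L (insert X.neg S) →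
      SetDerivable L (insert X.neg (insert A S)) :=
    fun A h => h.weaken (Set.insert_subset_insert (Set.subset_insert _ _))
  have hneg : ∀ {S R : Set (Form V)} {A : Form V}, R ⊆ insert X S → A.neg ∈ R → A.neg ∈ S :=
    fun hR h => (hR h).resolve_left fun h => hXn _ h.symm
  induction h generalizing S with
  | ax R A h1 h2 =>
    have h2 := hneg hR h2
    rcases hR h1 with rfl | h1
    -- Here `X.neg` already lies in `S`, so the right premise is the desired conclusion.
    · rwa [Set.insert_eq_of_mem h2] at h'
    · exact .ax _ A h1 h2
  | negBot R h => exact .negBot _ (hneg hR h)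
  | negConj R A B h _ ih =>
    have hm := hneg hR h
    have hr := hS.2 _ hm
    simp only [condRank] at hr
    refine .negConj _ A B hm (ih ((hS.insert ?_).insert ?_)
      (insert_subset_insert_insert (insert_subset_insert_insert hR)) (wk _ (wk _ h')))
    · simp only [condRank]; omega
    · simp only [condRank]; omega
  | conj R A B h _ _ ih1 ih2 =>
    have hm := (hR h).resolve_left fun h => hXc _ _ h.symm
    have hr := hS.2 _ hm
    simp only [condRank] at hr
    exact .conj _ A B hm
      (ih1 (hS.insert (by omega)) (insert_subset_insert_insert hR) (wk _ h'))
      (ih2 (hS.insert (by omega)) (insert_subset_insert_insert hR) (wk _ h'))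
  | negNeg R A h _ ih =>
    have hm := hneg hR h
    exact .negNeg _ A hm (ih (hS.insert (hS.lt_of_neg (A := A.neg) hm))
      (insert_subset_insert_insert hR) (wk _ h'))
  | modal R A₀ B₀ E T h h1 h2 h3 hT _ _ _ =>
    have hE : E ⊆ equivalents L A₀ := fun A hA => ⟨h1 A hA, h2 A hA⟩
    -- Apart from `B₀` and companions from `S`, the last premise can contain only the consequent of
    -- `X` itself, as a positive companion under `CEM`.
    have hT' : T ⊆ insert B₀ {x | (∃ C, X = C.cond x ∧ .CEM ∈ L ∧ C ∈ equivalents L A₀) ∨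
        x ∈ companions L S A₀} := by
      intro x hx
      rcases hT hx with hx | hx | ⟨A, B, hA, rfl, hm⟩ | ⟨hc, A, B, hA, rfl, hm⟩
      · exact Or.inl hx
      · exact Or.inr (Or.inr (Or.inl hx))
      · exact Or.inr (Or.inr (Or.inr (Or.inl ⟨A, B, hE hA, rfl, hneg hR hm⟩)))
      · rcases hR hm with rfl | hm
        · exact Or.inr (Or.inl ⟨A, rfl, hc, hE hA⟩)
        · exact Or.inr (Or.inr (Or.inr (Or.inr ⟨hc, A, x, hE hA, rfl, hm⟩)))
    rcases hR h with hX' | hm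
    · refine hmodal S A₀ B₀ hX'.symm hS (h3.weaken fun x hx => ?_) h'
      rcases hT' hx with hx | ⟨C, hC, _, _⟩ | hx
      · exact Or.inl hx
      · rw [← hX', cond.injEq] at hC
        exact Or.inl hC.2.symm
      · exact Or.inr hx
    -- Under `CEM` a side conditional can take the principal role: the reference is moved to its
    -- antecedent `C`, and `B₀` becomes a companion, contributed by `A₀ ⇒ B₀` in `S`.
    · by_cases hact : ∃ C D, X = C.cond D ∧ .CEM ∈ L ∧ C ∈ equivalents L A₀
      · obtain ⟨C, D, rfl, hc, hC⟩ := hact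
        have hrA := condRank_lt_of_cond (hS.2 _ hm)
        have hrC := condRank_lt_of_cond hX
        have h4 : SetDerivable L ({D, B₀} ∪ companions L S A₀) := by
          refine h3.weaken fun x hx => ?_
          rcases hT' hx with hx | ⟨C', hC', _, _⟩ | hx
          · exact Or.inl (Or.inr hx)
          · rw [cond.injEq] at hC'
            exact Or.inl (Or.inl hC'.2.symm)
          · exact Or.inr hx
        have hY : RankBelow n {D, B₀} := by
          refine ⟨Set.toFinite _, ?_⟩
          rintro x (rfl | rfl)
          exacts [hrC.2, hrA.2]
        refine hmodal S C D rfl hS ((h4.change_reference hcut hS hY hrA.1 hrC.1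
          (mem_equivalents_symm hC)).weaken ?_) h'
        rintro x ((rfl | rfl) | hx)
        · exact Or.inl rfl
        · exact Or.inr (Or.inr (Or.inr ⟨hc, A₀, x, mem_equivalents_symm hC, rfl, hm⟩))
        · exact Or.inr hx
      · refine .of_companions hm (h3.weaken fun x hx => ?_)
        rcases hT' hx with hx | ⟨C, hC⟩ | hx
        · exact Or.inl hx
        · exact absurd ⟨C, x, hC⟩ hact
        · exact Or.inr hx
  | mp R A B hM h _ _ ih1 ih2 =>
    have hm := hneg hR h
    have hr := condRank_lt_of_cond (hS.lt_of_neg hm)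
    exact .mp _ A B hM hm
      (ih1 (hS.insert (by omega)) (insert_subset_insert_insert hR) (wk _ h'))
      (ih2 (hS.insert (by simp only [condRank]; omega)) (insert_subset_insert_insert hR)
        (wk _ h'))
  | mpcem R A B hM hc h _ _ ih1 ih2 =>
    have hr : (A.cond B).condRank < n + 1 := by
      rcases hR h with h | h
      · rwa [h]
      · exact hS.2 _ h
    have hr := condRank_lt_of_cond hr
    have d1 := ih1 (hS.insert (by omega)) (insert_subset_insert_insert hR) (wk _ h')
    have d2 := ih2 (hS.insert (by omega)) (insert_subset_insert_insert hR) (wk _ h')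
    rcases hR h with hX' | hm
    · exact hmpcem S A B hX'.symm hS hM hc d1 d2 h'
    · exact .mpcem _ A B hM hc hm d1 d2

/-- Induction on the right premise of a cut on `C ⇒ D`, where `C ⇒ D` is principal in the last rule
of the derivation of the left premise. -/
theorem SetDerivable.cut_right {n : ℕ} (hcut : ∀ A : Form V, A.condRank < n → CutBelow L n A)
    {C D : Form V} (hX : (C.cond D).condRank < n + 1) (hcutC : CutBelow L (n + 1) C)
    (hcutD : CutBelow L (n + 1) D) {R : Set (Form V)} (h : SetDerivable L R)
    {S : Set (Form V)} (hS : RankBelow (n + 1) S) (hR : R ⊆ insert (C.cond D).neg S)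
    (h' : SetDerivable L (insert D (companions L S C)) ∨
      (.MP ∈ L ∧ .CEM ∈ L ∧ SetDerivable L (insert C S) ∧ SetDerivable L (insert D S))) :
    SetDerivable L S := by
  have hrC := condRank_lt_of_cond hX
  -- The data from the last left inference must be weakened along with `S`, which grows as the right
  -- derivation is followed upwards.
  have wk : ∀ {S : Set (Form V)} (A : Form V), (SetDerivable L (insert D (companions L S C)) ∨
      (.MP ∈ L ∧ .CEM ∈ L ∧ SetDerivable L (insert C S) ∧ SetDerivable L (insert D S))) →
      (SetDerivable L (insert D (companions L (insert A S) C)) ∨ (.MP ∈ L ∧ .CEM ∈ L ∧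
        SetDerivable L (insert C (insert A S)) ∧ SetDerivable L (insert D (insert A S)))) := by
    rintro S A (h | ⟨hM, hc, h1, h2⟩)
    · exact Or.inl (h.weaken (Set.insert_subset_insert (companions_mono (Set.subset_insert _ _) _)))
    · exact Or.inr ⟨hM, hc, h1.weaken (Set.insert_subset_insert (Set.subset_insert _ _)),
        h2.weaken (Set.insert_subset_insert (Set.subset_insert _ _))⟩
  induction h generalizing S with
  | ax R A h1 h2 =>
    rcases hR h1 with rfl | h1
    -- In this axiom `¬(C ⇒ D)` is the positive member, so `S` contains `¬¬(C ⇒ D)`; that formula is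
    -- unfolded and `C ⇒ D` derived again from the left data.
    · refine .negNeg _ (C.cond D) ((hR h2).resolve_left (by simp)) ?_
      rcases wk (C.cond D) h' with h' | ⟨hM, hc, h3, h4⟩
      · exact .of_companions (Set.mem_insert _ _) h'
      · exact .mpcem _ C D hM hc (Set.mem_insert _ _) h3 h4
    · rcases hR h2 with h2 | h2
      · obtain rfl : A = C.cond D := by simpa using h2
        rcases h' with h' | ⟨hM, hc, h3, h4⟩
        · exact .of_companions h1 h'
        · exact .mpcem _ C D hM hc h1 h3 h4
      · exact .ax _ A h1 h2
  | negBot R h => exact .negBot _ ((hR h).resolve_left (by simp))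
  | negConj R A B h _ ih =>
    have hm := (hR h).resolve_left (by simp)
    have hr := hS.2 _ hm
    simp only [condRank] at hr
    refine .negConj _ A B hm (ih ((hS.insert ?_).insert ?_)
      (insert_subset_insert_insert (insert_subset_insert_insert hR)) (wk _ (wk _ h')))
    · simp only [condRank]; omega
    · simp only [condRank]; omega
  | conj R A B h _ _ ih1 ih2 =>
    have hm := (hR h).resolve_left (by simp)
    have hr := hS.2 _ hm
    simp only [condRank] at hr
    exact .conj _ A B hm
      (ih1 (hS.insert (by omega)) (insert_subset_insert_insert hR) (wk _ h'))
      (ih2 (hS.insert (by omega)) (insert_subset_insert_insert hR) (wk _ h'))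
  | negNeg R A h _ ih =>
    have hm := (hR h).resolve_left (by simp)
    exact .negNeg _ A hm (ih (hS.insert (hS.lt_of_neg (A := A.neg) hm))
      (insert_subset_insert_insert hR) (wk _ h'))
  | modal R A₀ B₀ E T h h1 h2 h3 hT _ _ _ =>
    have hm := (hR h).resolve_left (by simp)
    have hrA := condRank_lt_of_cond (hS.2 _ hm)
    have hE : E ⊆ equivalents L A₀ := fun A hA => ⟨h1 A hA, h2 A hA⟩
    have hT' : T ⊆ insert B₀ {x | (x = D.neg ∧ C ∈ equivalents L A₀) ∨
        x ∈ companions L S A₀} := by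
      intro x hx
      rcases hT hx with hx | hx | ⟨A, B, hA, rfl, hm⟩ | ⟨hc, A, B, hA, rfl, hm⟩
      · exact Or.inl hx
      · exact Or.inr (Or.inr (Or.inl hx))
      · rcases hR hm with he | hm
        · simp only [neg.injEq, cond.injEq] at he
          exact Or.inr (Or.inl ⟨by rw [he.2], he.1 ▸ hE hA⟩)
        · exact Or.inr (Or.inr (Or.inr (Or.inl ⟨A, B, hE hA, rfl, hm⟩)))
      · exact Or.inr (Or.inr (Or.inr (Or.inr
          ⟨hc, A, x, hE hA, rfl, (hR hm).resolve_left (by simp)⟩)))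
    by_cases hact : C ∈ equivalents L A₀
    · have h4 : SetDerivable L ({D.neg, B₀} ∪ companions L S A₀) := by
        refine h3.weaken fun x hx => ?_
        rcases hT' hx with hx | ⟨hx, _⟩ | hx
        · exact Or.inl (Or.inr hx)
        · exact Or.inl (Or.inl hx)
        · exact Or.inr hx
      -- Against a modal left inference, the left premise is moved to reference `A₀` and `D` is cut
      -- at lower rank. Against `MPCEM`, the right premise is moved to `C`, and `D` is cut in the
      -- context `S` enlarged by the companions, which are then removed using the derivation of `C,
      -- S`.
      rcases h' with h' | ⟨hM, hc, h5, h6⟩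
      · have h5 : SetDerivable L ({D} ∪ companions L S A₀) :=
          SetDerivable.change_reference hcut hS ⟨Set.toFinite _, by rintro x rfl; exact hrC.2⟩
            hrC.1 hrA.1 hact h'
        refine .of_companions hm (hcut D hrC.2 _ ((hS.companions hrA.1).insert hrA.2)
          (h5.weaken ?_) (h4.weaken ?_))
        · exact Set.insert_subset_insert (Set.subset_insert _ _)
        · rintro x ((rfl | rfl) | hx)
          exacts [Or.inl rfl, Or.inr (Or.inl rfl), Or.inr (Or.inr hx)]
      · have hY : RankBelow n {D.neg, B₀} := by
          refine ⟨Set.toFinite _, ?_⟩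
          rintro x (rfl | rfl)
          exacts [hrC.2, hrA.2]
        have h7 := h4.change_reference hcut hS hY hrA.1 hrC.1 (mem_equivalents_symm hact)
        refine SetDerivable.remove_companions hM hcutC hS hrC.1 h5 (hcutD _
          (hS.union ((hS.companions hrC.1).mono subset_rfl n.le_succ))
          (h6.weaken (Set.insert_subset_insert Set.subset_union_left)) (h7.weaken ?_))
        rintro x ((rfl | rfl) | hx)
        · exact Or.inl rfl
        · exact Or.inr (Or.inr (Or.inr (Or.inr
            ⟨hc, A₀, x, mem_equivalents_symm hact, rfl, hm⟩)))
        · exact Or.inr (Or.inr hx)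
    · refine .of_companions hm (h3.weaken fun x hx => ?_)
      rcases hT' hx with hx | hx | hx
      · exact Or.inl hx
      · exact absurd hx.2 hact
      · exact Or.inr hx
  | mp R A B hM h _ _ ih1 ih2 =>
    have hr : (A.cond B).condRank < n + 1 := by
      rcases hR h with h | h
      · rw [neg.injEq] at h
        rwa [h]
      · exact hS.lt_of_neg h
    have hr := condRank_lt_of_cond hr
    have d1 := ih1 (hS.insert (by omega)) (insert_subset_insert_insert hR) (wk _ h')
    have d2 := ih2 (hS.insert (by simp only [condRank]; omega))
      (insert_subset_insert_insert hR) (wk _ h')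
    rcases hR h with he | hm
    · simp only [neg.injEq, cond.injEq] at he
      obtain ⟨rfl, rfl⟩ := he
      -- In the modal case the `MP` premise `d1` derives `C, S`, exactly what is needed to remove
      -- the companions after the cut on `D`.
      rcases h' with h' | ⟨_, _, _, h6⟩
      · exact SetDerivable.remove_companions hM hcutC hS hrC.1 d1 (hcutD _
          (hS.union ((hS.companions hrC.1).mono subset_rfl n.le_succ))
          (h'.weaken (Set.insert_subset_insert Set.subset_union_right))
          (d2.weaken (Set.insert_subset_insert Set.subset_union_left)))
      · exact hcutD S hS h6 d2
    · exact .mp _ A B hM hm d1 d2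
  | mpcem R A B hM hc h _ _ ih1 ih2 =>
    have hm := (hR h).resolve_left (by simp)
    have hr := condRank_lt_of_cond (hS.2 _ hm)
    exact .mpcem _ A B hM hc hm
      (ih1 (hS.insert (by omega)) (insert_subset_insert_insert hR) (wk _ h'))
      (ih2 (hS.insert (by omega)) (insert_subset_insert_insert hR) (wk _ h'))

theorem cutBelow (n : ℕ) (A : Form V) (hA : A.condRank < n) : CutBelow L n A := by
  induction n generalizing A with
  | zero => simp at hA
  | succ n hcut =>
    induction A with
    | bot =>
      intro S hS h h'
      exact h.cut_left hcut (by simp) (by simp) hA (by simp) (by simp) hS subset_rfl h'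
    | var p =>
      intro S hS h h'
      exact h.cut_left hcut (by simp) (by simp) hA (by simp) (by simp) hS subset_rfl h'
    | neg A ih => exact fun S hS h h' => ih hA S hS (h'.invert_negNeg hS.1) h
    | conj A B ihA ihB =>
      intro S hS h h'
      have hr : A.condRank < n + 1 ∧ B.condRank < n + 1 := by
        simpa only [condRank, max_lt_iff] using hA
      obtain ⟨h1, h2⟩ := h.invert_conj hS.1
      -- After inversion, `B` is cut first with `¬A` as part of the context, then `A`.
      refine ihA hr.1 S hS h1 (ihB hr.2 _ (hS.insert hr.1)
        (h2.weaken (Set.insert_subset_insert (Set.subset_insert _ _))) ?_)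
      rw [Set.insert_comm]
      exact h'.invert_negConj hS.1
    | cond C D ihC ihD =>
      have hr := condRank_lt_of_cond hA
      have hC := ihC (hr.1.trans n.lt_succ_self)
      have hD := ihD (hr.2.trans n.lt_succ_self)
      intro S hS h h'
      refine h.cut_left hcut (by simp) (by simp) hA ?_ ?_ hS subset_rfl h'
      · intro S C' D' he hS h1 h2
        obtain ⟨rfl, rfl⟩ := cond.inj he
        exact h2.cut_right hcut hA hC hD hS subset_rfl (Or.inl h1)
      · intro S C' D' he hS hM hc h1 h2 h3
        obtain ⟨rfl, rfl⟩ := cond.inj he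
        exact h3.cut_right hcut hA hC hD hS subset_rfl (Or.inr ⟨hM, hc, h1, h2⟩)

/-- Finiteness of `S` provides a common rank bound for context and cut formula. -/
theorem SetDerivable.cut {S : Set (Form V)} (hS : S.Finite) (A : Form V)
    (h : SetDerivable L (insert A S)) (h' : SetDerivable L (insert A.neg S)) :
    SetDerivable L S := by
  obtain ⟨m, hm⟩ := ((hS.insert A).image condRank).bddAbove
  have hle : ∀ x ∈ insert A S, x.condRank < m + 1 := fun x hx =>
    Nat.lt_succ_of_le (hm (Set.mem_image_of_mem _ hx))
  exact cutBelow (m + 1) A (hle _ (Set.mem_insert _ _)) S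
    ⟨hS, fun x hx => hle x (Set.mem_insert_of_mem _ hx)⟩ h h'

theorem GDerivable.mono {R R' : Set (Rule V)} (hR : R ⊆ R') {Γ : Sequent V}
    (h : GDerivable R Γ) : GDerivable R' Γ := by
  induction h with
  | ax A Γ => exact .ax A Γ
  | negBot Γ => exact .negBot Γ
  | negConj A B Γ _ ih => exact .negConj A B Γ ih
  | conj A B Γ _ _ ih1 ih2 => exact .conj A B Γ ih1 ih2
  | negNeg A Γ _ ih => exact .negNeg A Γ ih
  | rule r hr _ ih => exact .rule r (hR hr) ih

theorem gAdmissible_cutRules : GAdmissible (cutRules V) (sequentRules V L) := by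
  refine fun Γ => ⟨GDerivable.mono Set.subset_union_left, fun h => ?_⟩
  induction h with
  | ax A Γ => exact .ax A Γ
  | negBot Γ => exact .negBot Γ
  | negConj A B Γ _ ih => exact .negConj A B Γ ih
  | conj A B Γ _ _ ih1 ih2 => exact .conj A B Γ ih1 ih2
  | negNeg A Γ _ ih => exact .negNeg A Γ ih
  | rule r hr _ ih =>
    rcases hr with hr | ⟨A, Γ, Δ, rfl⟩
    · exact .rule r hr ih
    · have h1 := (ih (A ::ₘ Γ) (by simp)).setDerivable
      have h2 := (ih (A.neg ::ₘ Δ) (by simp)).setDerivable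
      refine gDerivable_iff_setDerivable.2 (SetDerivable.cut (Multiset.finite_toSet _) A
        (h1.weaken fun x => ?_) (h2.weaken fun x => ?_))
      · simp only [Set.mem_ofPred_eq, Multiset.mem_cons, Set.mem_insert_iff, Multiset.mem_add]
        tauto
      · simp only [Set.mem_ofPred_eq, Multiset.mem_cons, Set.mem_insert_iff, Multiset.mem_add]
        tauto

/-! ### Simulation of the Hilbert system -/

/-- The literal over `σ p` that is false under the valuation `v`. -/
noncomputable def falseLiteral (σ : V → Form V) (v : V → Prop) (p : V) : Form V :=
  open Classical in if v p then (σ p).neg else σ p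

/-- The propositional variables of a formula. -/
def Form.vars : Form V → List V
  | bot => []
  | var p => [p]
  | neg A => vars A
  | conj A B => vars A ++ vars B
  | cond A B => vars A ++ vars B

namespace SetDerivable

theorem imp_intro {S : Set (Form V)} {A B : Form V}
    (h : SetDerivable L (insert A.neg (insert B S))) : SetDerivable L (insert (A.imp B) S) := by
  refine .negConj _ A B.neg (Set.mem_insert _ _) (.negNeg _ B (by simp) (h.weaken ?_))
  intro x
  simp only [Set.mem_insert_iff]
  tauto

theorem imp_elim {A B : Form V} (h : SetDerivable L {A.imp B}) : SetDerivable L {A.neg, B} := by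
  have h : SetDerivable L (insert (A.conj B.neg).neg ∅) := by simpa [imp] using h
  have h := h.invert_negConj Set.finite_empty
  rw [Set.insert_comm] at h
  have h := h.invert_negNeg (Set.toFinite _)
  exact h.weaken fun x => by simp; tauto

theorem conj_elim {A B : Form V} (h : SetDerivable L {A.conj B}) :
    SetDerivable L {A} ∧ SetDerivable L {B} := by
  have h : SetDerivable L (insert (A.conj B) ∅) := by simpa using h
  simpa using h.invert_conj Set.finite_empty

theorem modus_ponens {A B : Form V} (h : SetDerivable L {A}) (h' : SetDerivable L {A.imp B}) :
    SetDerivable L {B} :=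
  cut (Set.toFinite _) A (h.weaken (by simp)) h'.imp_elim

theorem listConj_of_neg_mem {l : List (Form V)} {S : Set (Form V)} (h : ∀ A ∈ l, A.neg ∈ S) :
    SetDerivable L (insert (listConj l) S) := by
  induction l with
  | nil => exact .negBot _ (Set.mem_insert _ _)
  | cons A l ih =>
    have hA : A.neg ∈ S := h A List.mem_cons_self
    cases l with
    | nil => exact .ax _ A (Set.mem_insert _ _) (Or.inr hA)
    | cons B l =>
      refine .conj _ A (listConj (B :: l)) (Set.mem_insert _ _)
        (.ax _ A (Set.mem_insert _ _) (Or.inr (Or.inr hA))) ?_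
      exact (ih fun C hC => h C (List.mem_cons_of_mem _ hC)).weaken
        (Set.insert_subset_insert (Set.subset_insert _ _))

/-- Cut on the whole conjunction handles the list at once. -/
theorem listConj_elim {l : List (Form V)} {B : Form V}
    (h : SetDerivable L {(listConj l).neg, B}) :
    SetDerivable L (insert B {x | ∃ A ∈ l, x = A.neg}) := by
  refine cut ?_ (listConj l) (listConj_of_neg_mem fun A hA => Or.inr ⟨A, hA, rfl⟩) (h.weaken ?_)
  · refine (((List.finite_toSet l).image neg).subset ?_).insert B
    rintro x ⟨A, hA, rfl⟩
    exact ⟨A, hA, rfl⟩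
  · rintro x (rfl | rfl)
    exacts [Or.inl rfl, Or.inr (Or.inl rfl)]

theorem listConj_intro {l : List (Form V)} {S : Set (Form V)}
    (h : SetDerivable L ({x | ∃ A ∈ l, x = A.neg} ∪ S)) :
    SetDerivable L (insert (listConj l).neg S) := by
  induction l generalizing S with
  | nil => exact h.weaken (by simp)
  | cons A l ih =>
    cases l with
    | nil => exact h.weaken fun x => by simp [listConj]
    | cons B l =>
      refine .negConj _ A (listConj (B :: l)) (Set.mem_insert _ _) ?_
      rw [Set.insert_comm]
      refine ih (h.weaken ?_)
      rintro x (⟨C, hC, rfl⟩ | hx)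
      · rcases List.mem_cons.1 hC with rfl | hC
        · exact Or.inr (Or.inl rfl)
        · exact Or.inl ⟨C, hC, rfl⟩
      · exact Or.inr (Or.inr (Or.inr hx))

/-- Kalmár's lemma. Since sequents are disjunctive, the side literals are those false under `v`. -/
theorem of_eval {A : Form V} (hA : A.IsPropositional) (σ : V → Form V) (v : V → Prop)
    {S : Set (Form V)} (hS : ∀ p ∈ A.vars, falseLiteral σ v p ∈ S) :
    (A.eval v → SetDerivable L (insert (A.subst σ) S)) ∧
      (¬ A.eval v → SetDerivable L (insert (A.subst σ).neg S)) := by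
  induction A with
  | bot => exact ⟨False.elim, fun _ => .negBot _ (Set.mem_insert _ _)⟩
  | var p =>
    have h := hS p (by simp [vars])
    unfold falseLiteral at h
    refine ⟨fun hv => ?_, fun hv => ?_⟩
    · rw [if_pos (show v p from hv)] at h
      exact .ax _ (σ p) (Set.mem_insert _ _) (Or.inr h)
    · rw [if_neg (show ¬ v p from hv)] at h
      exact .ax _ (σ p) (Or.inr h) (Set.mem_insert _ _)
  | neg A ih =>
    refine ⟨(ih hA hS).2, fun hv => ?_⟩
    exact .negNeg _ (A.subst σ) (Set.mem_insert _ _)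
      (((ih hA hS).1 (not_not.1 hv)).weaken (Set.insert_subset_insert (Set.subset_insert _ _)))
  | conj A B ihA ihB =>
    have ihA := ihA hA.1 fun p hp => hS p (List.mem_append_left _ hp)
    have ihB := ihB hA.2 fun p hp => hS p (List.mem_append_right _ hp)
    refine ⟨fun hv => ?_, fun hv => ?_⟩
    · exact .conj _ (A.subst σ) (B.subst σ) (Set.mem_insert _ _)
        ((ihA.1 hv.1).weaken (Set.insert_subset_insert (Set.subset_insert _ _)))
        ((ihB.1 hv.2).weaken (Set.insert_subset_insert (Set.subset_insert _ _)))
    · refine .negConj _ (A.subst σ) (B.subst σ) (Set.mem_insert _ _) ?_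
      by_cases hv' : A.eval v
      · exact (ihB.2 fun h => hv ⟨hv', h⟩).weaken
          ((Set.insert_subset_insert (Set.subset_insert _ _)).trans (Set.subset_insert _ _))
      · exact (ihA.2 hv').weaken (Set.insert_subset_insert
          ((Set.subset_insert _ _).trans (Set.subset_insert _ _)))
  | cond A B _ _ => exact hA.elim

/-- The literals are eliminated one variable at a time: the two values of `p` give the premises of a
cut on `σ p`. -/
theorem of_forall_valuation {X : Form V} (σ : V → Form V) (l : List V)
    (h : ∀ v : V → Prop, SetDerivable L (insert X {x | ∃ p ∈ l, x = falseLiteral σ v p})) :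
    SetDerivable L {X} := by
  classical
  induction l with
  | nil => exact (h fun _ => True).weaken fun x => by simp
  | cons p l ih =>
    refine ih fun v => ?_
    -- Altering `v` at `p` affects only the literal of `p`; if `p` recurs in `l`, its occurrences
    -- all give that same literal.
    have hsub : ∀ b : Prop, {x | ∃ q ∈ p :: l, x = falseLiteral σ (Function.update v p b) q} ⊆
        insert (if b then (σ p).neg else σ p) {x | ∃ q ∈ l, x = falseLiteral σ v q} := by
      rintro b x ⟨q, hq, rfl⟩
      by_cases hqp : q = p
      · subst hqp
        exact Or.inl (by simp [falseLiteral])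
      · exact Or.inr ⟨q, (List.mem_cons.1 hq).resolve_left hqp, by simp [falseLiteral, hqp]⟩
    refine cut ?_ (σ p) ((h (Function.update v p False)).weaken ?_)
      ((h (Function.update v p True)).weaken ?_)
    · refine (((List.finite_toSet l).image (falseLiteral σ v)).subset ?_).insert X
      rintro x ⟨q, hq, rfl⟩
      exact ⟨q, hq, rfl⟩
    · rw [Set.insert_comm]
      exact Set.insert_subset_insert (by simpa using hsub False)
    · rw [Set.insert_comm]
      exact Set.insert_subset_insert (by simpa using hsub True)

theorem of_isTautology {A : Form V} (hA : A.IsTautology) (σ : V → Form V) :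
    SetDerivable L {A.subst σ} :=
  of_forall_valuation σ A.vars fun v =>
    (of_eval hA.1 σ v (S := {x | ∃ q ∈ A.vars, x = falseLiteral σ v q})
      fun p hp => ⟨p, hp, rfl⟩).1 (hA.2 v)

/-- Provable equivalence makes `A ⇒ B` active for reference `A'`, so `¬B` joins `B` in the modal
premise, an axiom. -/
theorem iff_cond {A A' B : Form V} (h : SetDerivable L {A.iff A'}) :
    SetDerivable L {(A.cond B).iff (A'.cond B)} := by
  have h1 := h.conj_elim.1.imp_elim
  have h2 := h.conj_elim.2.imp_elim
  have key : ∀ A A' : Form V, SetDerivable L {A.neg, A'} → SetDerivable L {A'.neg, A} →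
      ∀ S : Set (Form V), SetDerivable L (insert ((A.cond B).imp (A'.cond B)) S) := by
    intro A A' h1 h2 S
    refine imp_intro (.of_companions (A := A') (B := B) (by simp) (.ax _ B (by simp) ?_))
    exact Or.inr (Or.inr (Or.inl ⟨A, B, ⟨h2, h1⟩, rfl, by simp⟩))
  exact .conj _ _ _ rfl (key A A' h1 h2 _) (key A' A h2 h1 _)

theorem listConj_cond {A B : Form V} {l : List (Form V)}
    (h : SetDerivable L {(listConj l).imp B}) :
    SetDerivable L {(listConj (l.map fun C => A.cond C)).imp (A.cond B)} := by
  rw [← insert_empty_eq]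
  refine imp_intro (listConj_intro (.of_companions (A := A) (B := B) (by simp)
    (h.imp_elim.listConj_elim.weaken (Set.insert_subset_insert ?_))))
  rintro x ⟨C, hC, rfl⟩
  exact Or.inr (Or.inl ⟨A, C, mem_equivalents_self A, rfl,
    Or.inl ⟨_, List.mem_map.2 ⟨C, hC, rfl⟩, rfl⟩⟩)

theorem of_principleRules {P : Principle} (hP : P ∈ L) {r : Rule V}
    (hr : r ∈ principleRules V P) : SetDerivable L {bigDisj r.conclusion} := by
  cases P with
  | ID =>
    obtain ⟨A, rfl⟩ := hr
    refine .of_companions (A := A) (B := A) (by simp [bigDisj, listDisj]) (.ax _ A (by simp) ?_)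
    exact Or.inr (Or.inl ⟨hP, rfl⟩)
  | MP =>
    obtain ⟨A, B, rfl⟩ := hr
    simp only [bigDisj, Multiset.toList_singleton, listDisj]
    rw [← insert_empty_eq]
    refine imp_intro ?_
    rw [Set.insert_comm]
    exact imp_intro (.mp _ A B hP (by simp) (.ax _ A (by simp) (by simp))
      (.ax _ B (by simp) (by simp)))
  | CEM =>
    obtain ⟨A, B, rfl⟩ := hr
    simp only [bigDisj, Multiset.toList_singleton, listDisj]
    refine .negConj _ (A.cond B).neg (A.cond B.neg).neg rfl
      (.negNeg _ (A.cond B) (by simp) (.negNeg _ (A.cond B.neg) (by simp)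
        (.of_companions (A := A) (B := B) (by simp) (.ax _ B (by simp) ?_))))
    exact Or.inr (Or.inr (Or.inr ⟨hP, A, _, mem_equivalents_self A, rfl, by simp⟩))

theorem of_hDerivable {A : Form V} (h : HDerivable (hilbertRules V L) A) :
    SetDerivable L {A} := by
  induction h with
  | taut A σ hA => exact of_isTautology hA σ
  | mp A B _ _ ih1 ih2 => exact ih1.modus_ponens ih2
  | rule r hr _ ih =>
    rcases hr with (⟨A, A', B, rfl⟩ | ⟨A, B, l, rfl⟩) | ⟨P, hP, hr⟩
    · simp only [List.mem_singleton, forall_eq, bigDisj, Multiset.toList_singleton, listDisj] at ih ⊢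
      exact ih.iff_cond
    · simp only [List.mem_singleton, forall_eq, bigDisj, Multiset.toList_singleton, listDisj] at ih ⊢
      exact ih.listConj_cond
    · exact of_principleRules hP hr

end SetDerivable

end CondLogic

theorem mainTheorem3 {V : Type*} (L : Finset CondLogic.Principle) :
    (∀ A : CondLogic.Form V, CondLogic.HDerivable (CondLogic.hilbertRules V L) A →
      CondLogic.GDerivable (CondLogic.sequentRules V L) {A}) ∧
    CondLogic.GAdmissible (CondLogic.cutRules V) (CondLogic.sequentRules V L) :=
  ⟨fun _ h => CondLogic.gDerivable_iff_setDerivable.2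
    ((CondLogic.SetDerivable.of_hDerivable h).weaken (by simp)),
    CondLogic.gAdmissible_cutRules⟩
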